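/- Let $k$ be an algebraically closed field, let $Q=(Q_0,Q_1)$ be a finite quiver (loops, multiple arrows and oriented cycles are allowed), and let $d=(d_i)_{i\in Q_0}\in\mathbb{N}_0^{Q_0}$. Put $\mathrm{R}_d=\prod_{(i\to j)\in Q_1}\mathrm{Hom}_k(k^{d_i},k^{d_j})$, on which $\mathrm{GL}_d=\prod_{i\in Q_0}\mathrm{GL}_{d_i}(k)$ acts by conjugation, $(g\cdot M)_{i\to j}=g_jM_{i\to j}g_i^{-1}$. Let $\mathbf{d}=(\mathbf{d}^{(1)},\dots,\mathbf{d}^{(s)}=d)$ be a sequence of dimension vectors with $\mathbf{d}^{(t-1)}_i\le\mathbf{d}^{(t)}_i$ for all $i\in Q_0$ and $1\le t\le s$, where $\mathbf{d}^{(0)}=0$. For each $i\in Q_0$ fix a flag $0=F_i^{(0)}\subseteq F_i^{(1)}\subseteq\dots\subseteq F_i^{(s)}=k^{d_i}$ with $\dim F_i^{(t)}=\mathbf{d}_i^{(t)}$, let $$P=\{g\in\mathrm{GL}_d\mid g_iF_i^{(t)}\subseteq F_i^{(t)}\ \text{for all } i\in Q_0,\ 1\le t\le s\},$$ and identify $\mathrm{GL}_d/P$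 with the variety of all $Q_0$-graded flags $U=(U_i^{(t)})$ in $(k^{d_i})_{i\in Q_0}$ with $\dim U_i^{(t)}=\mathbf{d}_i^{(t)}$ (and $U_i^{(0)}=0$) via $gP\leftrightarrow gF$. Let $$\mathrm{R}_{\mathbf{d}}=\{M\in\mathrm{R}_d\mid M_{i\to j}(F_i^{(t)})\subseteq F_j^{(t-1)}\ \text{for all } (i\to j)\in Q_1,\ 1\le t\le s\},$$ a $P$-stable linear subspace of $\mathrm{R}_d$; let $$\mathcal{X}_{\mathbf{d}}=\{(M,U)\in\mathrm{R}_d\times\mathrm{GL}_d/P\mid M_{i\to j}(U_i^{(t)})\subseteq U_j^{(t-1)}\ \text{for all } (i\to j)\in Q_1,\ 1\le t\le s\},$$ with the diagonal $\mathrm{GL}_d$-action; and let $\pi_{\mathbf{d}}\colon\mathrm{GL}_d\times^{P}\mathrm{R}_{\mathbf{d}}\to\mathrm{R}_d$, $[g,x]\mapsto g\cdot x$. Via the $\mathrm{GL}_d$-equivariant isomorphism $\mathrm{GL}_d\times^{P}\mathrm{R}_{\mathbf{d}}\cong\mathcal{X}_{\mathbf{d}}$, $[g,x]\mapsto(g\cdot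 x,gP)$, over $\mathrm{R}_d$, the fibre $\pi_{\mathbf{d}}^{-1}(M)$ is identified with the variety of all $U\in\mathrm{GL}_d/P$ such that $(M,U)\in\mathcal{X}_{\mathbf{d}}$. The group $\mathrm{Aut}_Q(M)=\{g\in\mathrm{GL}_d\mid g_jM_{i\to j}=M_{i\to j}g_i\ \text{for all } (i\to j)\in Q_1\}$ acts on this fibre. All varieties carry the Zariski topology. Then the following three statements are equivalent: 1. The variety $\mathrm{R}_{\mathbf{d}}$ has a dense $P$-orbit. 2. The variety $\mathcal{X}_{\mathbf{d}}$ has a dense $\mathrm{GL}_d$-orbit. 3. The image of $\pi_{\mathbf{d}}$ has a dense $\mathrm{GL}_d$-orbit $\mathcal{O}$, and for every point $M\in\mathcal{O}$ the fibre $\pi_{\mathbf{d}}^{-1}(M)$ has a dense $\mathrm{Aut}_Q(M)$-orbit. -/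

import Mathlib

universe u v w

namespace QuiverRichardson

/-- The Zariski topology on the affine space `k^ι`: the closed sets are the common zero sets of
families of polynomials. -/
@[reducible]
def affineZariski (k : Type w) [Field k] (ι : Type*) : TopologicalSpace (ι → k) :=
  TopologicalSpace.ofClosed
    {Z | ∃ S : Set (MvPolynomial ι k), Z = {x | ∀ p ∈ S, MvPolynomial.eval x p = 0}}
    ⟨{1}, by ext x; simp⟩
    (by
      intro A hA
      refine ⟨{p | ∀ x ∈ ⋂₀ A, MvPolynomial.eval x p = 0}, ?_⟩
      ext x
      constructor
      · intro hx p hp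
        exact hp x hx
      · intro hx Z hZ
        obtain ⟨S, rfl⟩ := hA hZ
        intro p hp
        exact hx p (fun y hy => hy _ hZ p hp))
    (by
      rintro _ ⟨S, rfl⟩ _ ⟨T, rfl⟩
      refine ⟨{r | ∃ p ∈ S, ∃ q ∈ T, r = p * q}, ?_⟩
      ext x
      constructor
      · rintro (hx | hx) _ ⟨p, hp, q, hq, rfl⟩
        · simp [hx p hp]
        · simp [hx q hq]
      · intro hx
        by_contra hcon
        simp only [Set.mem_union, Set.mem_ofPred_eq, not_or, not_forall] at hcon
        obtain ⟨⟨p, hp, hp0⟩, q, hq, hq0⟩ := hcon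
        have h := hx (p * q) ⟨p, hp, q, hq, rfl⟩
        rw [map_mul] at h
        exact (mul_ne_zero hp0 hq0) h)

variable {V : Type u} [Quiver.{v} V]

/-- The representation space `rep_d = ∏_{a : i → j} Hom(k^{d_i}, k^{d_j})` of a quiver. -/
def QuiverRep (k : Type w) [Field k] (d : V → ℕ) : Type (max u v w) :=
  ∀ ⦃i j : V⦄, (i ⟶ j) → Matrix (Fin (d j)) (Fin (d i)) k

/-- The group `GL_d = ∏_i GL_{d_i}(k)`. -/
def GLd {V : Type u} (k : Type w) [Field k] (d : V → ℕ) : Type (max u w) :=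
  ∀ i : V, GL (Fin (d i)) k

instance {V : Type u} (k : Type w) [Field k] (d : V → ℕ) : Group (GLd k d) :=
  inferInstanceAs (Group (∀ i : V, GL (Fin (d i)) k))

variable {k : Type w} [Field k] {d : V → ℕ}

/-- `GL_d` acts on `rep_d` by conjugation: `(g • M)_a = g_j M_a g_i⁻¹` for `a : i → j`. -/
instance : MulAction (GLd k d) (QuiverRep k d) where
  smul g M := fun i j a =>
    (g j).val * M a *
      ((g i)⁻¹ : GL (Fin (d i)) k).val
  one_smul M := by
    funext i j a
    change (1 : GL (Fin (d j)) k).val * M a *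
      ((1 : GL (Fin (d i)) k)⁻¹).val = M a
    simp
  mul_smul g h M := by
    funext i j a
    change (g j * h j : GL (Fin (d j)) k).val * M a *
      ((g i * h i : GL (Fin (d i)) k)⁻¹).val =
      (g j).val * ((h j).val * M a * ((h i)⁻¹).val) * ((g i)⁻¹).val
    rw [mul_inv_rev, Units.val_mul, Units.val_mul]
    simp only [Matrix.mul_assoc]

/-- Matrix entries as affine coordinates on `rep_d`. -/
def repCoord (M : QuiverRep k d) : (Σ (i j : V), (i ⟶ j) × Fin (d j) × Fin (d i)) → k :=
  fun x => M x.2.2.1 x.2.2.2.1 x.2.2.2.2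

/-- Matrix entries as coordinates on `GL_d`, an open subset of the affine space of matrix tuples. -/
def glCoord {V : Type u} {k : Type w} [Field k] {d : V → ℕ} (g : GLd k d) :
    (Σ i : V, Fin (d i) × Fin (d i)) → k :=
  fun x => (g x.1).val x.2.1 x.2.2

/-- The Zariski topology on `rep_d`. -/
instance : TopologicalSpace (QuiverRep k d) :=
  (affineZariski k _).induced repCoord

/-- The Zariski topology on `GL_d`, as an open subvariety of affine space. -/
instance {V : Type u} {k : Type w} [Field k] {d : V → ℕ} : TopologicalSpace (GLd k d) :=
  (affineZariski k _).induced glCoord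

/-- The Zariski topology on the product variety `rep_d × GL_d`
(finer than the product of the Zariski topologies). -/
@[reducible]
def zariskiRepGL : TopologicalSpace (QuiverRep k d × GLd k d) :=
  (affineZariski k _).induced fun x => Sum.elim (repCoord x.1) (glCoord x.2)

/-- A dimension filtration `0 = dd⁽⁰⁾ ≤ dd⁽¹⁾ ≤ ⋯ ≤ dd⁽ˢ⁾ = d` of the dimension vector `d`. -/
structure DimFiltration {V : Type u} (d : V → ℕ) (s : ℕ) where
  dim : Fin (s + 1) → V → ℕ
  dim_zero : ∀ i, dim 0 i = 0
  dim_last : ∀ i, dim (Fin.last s) i = d i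
  dim_le : ∀ (t : Fin s) (i : V), dim t.castSucc i ≤ dim t.succ i

/-- A `V`-graded flag `F_i⁽⁰⁾ ⊆ F_i⁽¹⁾ ⊆ ⋯ ⊆ F_i⁽ˢ⁾` in `k^{d_i}` with `dim F_i⁽ᵗ⁾ = dd⁽ᵗ⁾_i`;
by dimension `F_i⁽⁰⁾ = 0` and `F_i⁽ˢ⁾ = k^{d_i}`. -/
structure GradedFlag {V : Type u} (k : Type w) [Field k] {d : V → ℕ} {s : ℕ}
    (dd : DimFiltration d s) where
  space : ∀ i : V, Fin (s + 1) → Submodule k (Fin (d i) → k)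
  space_le : ∀ (i : V) (t : Fin s), space i t.castSucc ≤ space i t.succ
  finrank_space : ∀ (i : V) (t : Fin (s + 1)), Module.finrank k (space i t) = dd.dim t i

/-- The image `g_i W` of a subspace `W ⊆ k^{d_i}` under `g ∈ GL_d`. -/
def translate {V : Type u} {k : Type w} [Field k] {d : V → ℕ} (g : GLd k d) (i : V)
    (W : Submodule k (Fin (d i) → k)) : Submodule k (Fin (d i) → k) :=
  W.map (Matrix.mulVecLin (g i).val)

theorem translate_one {V : Type u} {k : Type w} [Field k] {d : V → ℕ} (i : V)
    (W : Submodule k (Fin (d i) → k)) : translate (1 : GLd k d) i W = W := by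
  change W.map (Matrix.mulVecLin (1 : GL (Fin (d i)) k).val) = W
  simp

theorem translate_mul {V : Type u} {k : Type w} [Field k] {d : V → ℕ} (g h : GLd k d) (i : V)
    (W : Submodule k (Fin (d i) → k)) :
    translate (g * h) i W = translate g i (translate h i W) := by
  change W.map (Matrix.mulVecLin (g i * h i : GL (Fin (d i)) k).val) = _
  rw [Units.val_mul, Matrix.mulVecLin_mul, Submodule.map_comp]
  rfl

theorem translate_mono {V : Type u} {k : Type w} [Field k] {d : V → ℕ} (g : GLd k d) (i : V)
    {W W' : Submodule k (Fin (d i) → k)} (h : W ≤ W') : translate g i W ≤ translate g i W' :=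
  Submodule.map_mono h

theorem finrank_translate {V : Type u} {k : Type w} [Field k] {d : V → ℕ} (g : GLd k d) (i : V)
    (W : Submodule k (Fin (d i) → k)) :
    Module.finrank k (translate g i W) = Module.finrank k W := by
  apply le_antisymm
  · exact Submodule.finrank_map_le _ _
  · have h : translate g⁻¹ i (translate g i W) = W := by
      rw [← translate_mul, inv_mul_cancel, translate_one]
    calc Module.finrank k W = Module.finrank k (translate g⁻¹ i (translate g i W)) := by rw [h]
      _ ≤ _ := Submodule.finrank_map_le _ _

variable {s : ℕ} {dd : DimFiltration d s}

/-- The parabolic subgroup `P = {g ∈ GL_d | g_i F_i⁽ᵗ⁾ ⊆ F_i⁽ᵗ⁾ for all i, t}`. -/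
def parabolic {V : Type u} {k : Type w} [Field k] {d : V → ℕ} {s : ℕ} {dd : DimFiltration d s}
    (F : GradedFlag k dd) : Subgroup (GLd k d) where
  carrier := {g | ∀ i t, translate g i (F.space i t) ≤ F.space i t}
  one_mem' := fun i t => (translate_one i _).le
  mul_mem' := fun {g h} hg hh i t => by
    rw [translate_mul]
    exact (translate_mono g i (hh i t)).trans (hg i t)
  inv_mem' := fun {g} hg i t => by
    have h : translate g i (F.space i t) = F.space i t :=
      Submodule.eq_of_le_of_finrank_eq (hg i t) (finrank_translate g i _)
    have h' : translate g⁻¹ i (translate g i (F.space i t)) = F.space i t := by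
      rw [← translate_mul, inv_mul_cancel, translate_one]
    rw [h] at h'
    exact h'.le

theorem translate_of_mem_parabolic {V : Type u} {k : Type w} [Field k] {d : V → ℕ} {s : ℕ}
    {dd : DimFiltration d s} (F : GradedFlag k dd) {g : GLd k d} (hg : g ∈ parabolic F) (i : V)
    (t : Fin (s + 1)) : translate g i (F.space i t) = F.space i t :=
  Submodule.eq_of_le_of_finrank_eq (hg i t) (finrank_translate g i _)

/-- `M_a (U_i⁽ᵗ⁾) ⊆ U_j⁽ᵗ⁻¹⁾` for all arrows `a : i → j` and all `1 ≤ t ≤ s`. -/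
def Lowers (M : QuiverRep k d) (U : ∀ i : V, Fin (s + 1) → Submodule k (Fin (d i) → k)) : Prop :=
  ∀ ⦃i j : V⦄ (a : i ⟶ j) (t : Fin s), ∀ x ∈ U i t.succ, (M a).mulVec x ∈ U j t.castSucc

theorem Lowers.smul {M : QuiverRep k d} {U : ∀ i : V, Fin (s + 1) → Submodule k (Fin (d i) → k)}
    (h : Lowers M U) (g : GLd k d) : Lowers (g • M) (fun i t => translate g i (U i t)) := by
  rintro i j a t _ ⟨x, hx, rfl⟩
  refine ⟨(M a).mulVec x, h a t x hx, ?_⟩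
  change (g j).val.mulVec ((M a).mulVec x) =
    ((g j).val * M a * ((g i)⁻¹).val).mulVec ((g i).val.mulVec x)
  rw [Matrix.mulVec_mulVec, Matrix.mulVec_mulVec, Matrix.mul_assoc _ _ (g i).val, Units.inv_mul,
    Matrix.mul_one]

/-- The variety `R_dd = {M ∈ rep_d | M_a (F_i⁽ᵗ⁾) ⊆ F_j⁽ᵗ⁻¹⁾}` with its action of `P`. -/
def repFlag (F : GradedFlag k dd) : SubMulAction (parabolic F) (QuiverRep k d) where
  carrier := {M | Lowers M F.space}
  smul_mem' := by
    intro p M hM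
    have h := Lowers.smul hM (p : GLd k d)
    have e : (fun i t => translate (p : GLd k d) i (F.space i t)) = F.space := by
      funext i t
      exact translate_of_mem_parabolic F p.2 i t
    rw [e] at h
    exact h

/-- The `V`-graded flag `U = gF` which corresponds to the point `gP` of `GL_d/P`. -/
def cosetFlag {V : Type u} {k : Type w} [Field k] {d : V → ℕ} {s : ℕ} {dd : DimFiltration d s}
    (F : GradedFlag k dd) (U : GLd k d ⧸ parabolic F) :
    ∀ i : V, Fin (s + 1) → Submodule k (Fin (d i) → k) :=
  Quotient.liftOn' U (fun g i t => translate g i (F.space i t)) (by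
    intro g h hgh
    have hp : g⁻¹ * h ∈ parabolic F := QuotientGroup.leftRel_apply.mp hgh
    funext i t
    have e : h = g * (g⁻¹ * h) := by group
    conv_rhs => rw [e, translate_mul, translate_of_mem_parabolic F hp])

theorem cosetFlag_smul {V : Type u} {k : Type w} [Field k] {d : V → ℕ} {s : ℕ}
    {dd : DimFiltration d s} (F : GradedFlag k dd) (g : GLd k d) (U : GLd k d ⧸ parabolic F) :
    cosetFlag F (g • U) = fun i t => translate g i (cosetFlag F U i t) := by
  induction U using QuotientGroup.induction_on with
  | H h =>
    funext i t
    exact translate_mul g h i _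

/-- The set of points of the product variety `rep_d × GL_d/P`. -/
@[ext]
structure RepProdFlag (F : GradedFlag k dd) where
  rep : QuiverRep k d
  flag : GLd k d ⧸ parabolic F

/-- The Zariski topology on `rep_d × GL_d/P`. This variety is the quotient of `rep_d × GL_d` by
`P`, so a subset is closed iff its preimage in `rep_d × GL_d` is closed. (Likewise `GL_d/P`
carries the quotient topology of `GL_d`, which is Mathlib's instance on quotient groups.) -/
instance (F : GradedFlag k dd) : TopologicalSpace (RepProdFlag F) :=
  TopologicalSpace.coinduced
    (fun x : QuiverRep k d × GLd k d => ⟨x.1, (x.2 : GLd k d ⧸ parabolic F)⟩) zariskiRepGL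

/-- The diagonal action of `GL_d` on `rep_d × GL_d/P`. -/
instance (F : GradedFlag k dd) : MulAction (GLd k d) (RepProdFlag F) where
  smul g x := ⟨g • x.rep, g • x.flag⟩
  one_smul x := RepProdFlag.ext (one_smul _ x.rep) (one_smul _ x.flag)
  mul_smul g h x := RepProdFlag.ext (mul_smul g h x.rep) (mul_smul g h x.flag)

/-- The incidence variety `{(M, U) ∈ rep_d × GL_d/P | M_a (U_i⁽ᵗ⁾) ⊆ U_j⁽ᵗ⁻¹⁾}` with its action
of `GL_d`. -/
def incidence (F : GradedFlag k dd) : SubMulAction (GLd k d) (RepProdFlag F) where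
  carrier := {x | Lowers x.rep (cosetFlag F x.flag)}
  smul_mem' := by
    intro g x hx
    change Lowers (g • x.rep) (cosetFlag F (g • x.flag))
    rw [cosetFlag_smul]
    exact Lowers.smul hx g

/-- The relation `(g, x) ∼ (g p⁻¹, p x)`, `p ∈ P`, on `GL_d × R_dd`. -/
def bundleSetoid (F : GradedFlag k dd) : Setoid (GLd k d × repFlag F) where
  r y z := ∃ p : parabolic F, z.1 = y.1 * (p : GLd k d)⁻¹ ∧ z.2 = p • y.2
  iseqv :=
    { refl := fun y => ⟨1, by simp, by simp⟩
      symm := by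
        rintro y z ⟨p, h1, h2⟩
        exact ⟨p⁻¹, by simp [h1], by simp [h2]⟩
      trans := by
        rintro x y z ⟨p, h1, h2⟩ ⟨q, h3, h4⟩
        exact ⟨q * p, by simp [h3, h1, mul_assoc], by rw [h4, h2, mul_smul]⟩ }

/-- The associated fibre bundle `GL_d ×^P R_dd`. -/
def Bundle (F : GradedFlag k dd) : Type _ := Quotient (bundleSetoid F)

/-- The collapsing map `π_dd : GL_d ×^P R_dd → rep_d`, `[g, x] ↦ g • x`. -/
def collapse (F : GradedFlag k dd) : Bundle F → QuiverRep k d :=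
  Quotient.lift (fun y => y.1 • (y.2 : QuiverRep k d)) (by
    rintro y z ⟨p, h1, h2⟩
    have h : (z.2 : QuiverRep k d) = (p : GLd k d) • (y.2 : QuiverRep k d) := by rw [h2]; rfl
    change y.1 • (y.2 : QuiverRep k d) = z.1 • (z.2 : QuiverRep k d)
    rw [h, h1, smul_smul, inv_mul_cancel_right])

/-- The image of `π_dd`, with its action of `GL_d`. -/
def collapseImage (F : GradedFlag k dd) : SubMulAction (GLd k d) (QuiverRep k d) where
  carrier := Set.range (collapse F)
  smul_mem' := by
    rintro g _ ⟨y, rfl⟩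
    induction y using Quotient.inductionOn with
    | h y => exact ⟨Quotient.mk (bundleSetoid F) (g * y.1, y.2), mul_smul g y.1 _⟩

/-- `Aut_Q(M)`: the elements of `GL_d` which are endomorphisms of the representation `M`. -/
def autQ (M : QuiverRep k d) : Subgroup (GLd k d) where
  carrier := {g | ∀ ⦃i j : V⦄ (a : i ⟶ j), (g j).val * M a = M a * (g i).val}
  one_mem' := fun i j a => by
    change (1 : GL (Fin (d j)) k).val * M a = M a * (1 : GL (Fin (d i)) k).val
    simp
  mul_mem' := fun {g h} hg hh i j a => by
    change (g j * h j : GL (Fin (d j)) k).val * M a = M a * (g i * h i : GL (Fin (d i)) k).val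
    rw [Units.val_mul, Units.val_mul, Matrix.mul_assoc, hh a, ← Matrix.mul_assoc, hg a,
      Matrix.mul_assoc]
  inv_mem' := fun {g} hg i j a => by
    change ((g j)⁻¹).val * M a = M a * ((g i)⁻¹).val
    have h1 : M a = (g j).val * M a * ((g i)⁻¹).val := by
      rw [hg a, Matrix.mul_assoc, Units.mul_inv, Matrix.mul_one]
    conv_lhs => rw [h1]
    rw [Matrix.mul_assoc, ← Matrix.mul_assoc, Units.inv_mul, Matrix.one_mul]

theorem smul_eq_of_mem_autQ {M : QuiverRep k d} {g : GLd k d} (hg : g ∈ autQ M) : g • M = M := by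
  funext i j a
  change (g j).val * M a * ((g i)⁻¹).val = M a
  rw [hg a, Matrix.mul_assoc, Units.mul_inv, Matrix.mul_one]

/-- The fibre `π_dd⁻¹(M)`, as the variety of all flags `U ∈ GL_d/P` with
`M_a (U_i⁽ᵗ⁾) ⊆ U_j⁽ᵗ⁻¹⁾`, with its action of `Aut_Q(M)`. -/
def fibre (F : GradedFlag k dd) (M : QuiverRep k d) :
    SubMulAction (autQ M) (GLd k d ⧸ parabolic F) where
  carrier := {U | Lowers M (cosetFlag F U)}
  smul_mem' := by
    intro g U hU
    have h := Lowers.smul hU (g : GLd k d)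
    rw [smul_eq_of_mem_autQ g.2, ← cosetFlag_smul] at h
    exact h

/-- The space `X` has a dense `G`-orbit. -/
def HasDenseOrbit (G X : Type*) [Group G] [MulAction G X] [TopologicalSpace X] : Prop :=
  ∃ x : X, Dense (MulAction.orbit G x)

end QuiverRichardson

/-! Density is tested throughout against closed sets `C`: an orbit is dense when every closed `C`
containing it contains everything. 1 ⇔ 2: the incidence variety is swept out by the translates of
`repFlag F`, one over each coset `gP`, and `P`-orbits in `repFlag F` correspond to `GL_d`-orbits of
incidence points. Closed sets pass both ways: restrict to a slice, or spread a closed `Z` by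
demanding `h⁻¹ • M ∈ Z` for every representative `h` of the coset. 2 ⇔ 3 rests on
`exists_local_section`: near `M` the orbit map `g ↦ g • M` has a regular section over the orbit
closure. The space `Hom_Q(M, N)` solves a linear system depending regularly on `N`, with constant
dimension for `N` in the orbit, so Cramer's rule extends the identity of `M` to a regular family of
homomorphisms `M → N` (`exists_family_of_mem_ker`), invertible where the determinants do not vanish.
This works in every characteristic. 2 ⇒ 3: projecting a dense orbit gives a dense orbit in the
image, and the section turns a closed set in the fibre over `M` into a closed set of incidence
points. 3 ⇒ 2: a closed `C` containing the orbit contains all incidence points over the orbit of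
`M`, by density in the fibres. Any other incidence point is joined to one over `M` by a rational
curve inside the incidence variety. The section shows that the orbit is open in its closure, so most
of the curve lies over the orbit, and irreducibility of the line puts the whole curve in `C`. -/

namespace QuiverRichardson

/-! ### Regular functions and the Zariski topology -/

section Regular

open scoped Topology

variable {k : Type*} [Field k] {X Y ι κ : Type*}

/-- The functions on `X` which are quotients of polynomials in the coordinates `c`, with a
denominator that vanishes nowhere on `X`. -/
def regularFunctions (c : X → ι → k) : Subalgebra k (X → k) where
  carrier := {f | ∃ p q : MvPolynomial ι k, (∀ x, MvPolynomial.eval (c x) q ≠ 0) ∧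
    ∀ x, MvPolynomial.eval (c x) q * f x = MvPolynomial.eval (c x) p}
  mul_mem' := by
    rintro f g ⟨p, q, hq, h⟩ ⟨p', q', hq', h'⟩
    refine ⟨p * p', q * q', fun x => ?_, fun x => ?_⟩
    · simpa using ⟨hq x, hq' x⟩
    · simp only [map_mul, Pi.mul_apply, ← h, ← h']
      ring
  add_mem' := by
    rintro f g ⟨p, q, hq, h⟩ ⟨p', q', hq', h'⟩
    refine ⟨p * q' + p' * q, q * q', fun x => ?_, fun x => ?_⟩
    · simpa using ⟨hq x, hq' x⟩
    · simp only [map_mul, map_add, Pi.add_apply, ← h, ← h']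
      ring
  algebraMap_mem' := fun r => ⟨MvPolynomial.C r, 1, fun x => by simp, fun x => by simp⟩

theorem coord_mem_regularFunctions (c : X → ι → k) (j : ι) :
    (fun x => c x j) ∈ regularFunctions c :=
  ⟨MvPolynomial.X j, 1, fun x => by simp, fun x => by simp⟩

theorem const_mem (A : Subalgebra k (X → k)) (r : k) : (fun _ => r) ∈ A :=
  A.algebraMap_mem r

theorem inv_mem_regularFunctions {c : X → ι → k} {f : X → k} (hf : f ∈ regularFunctions c)
    (h0 : ∀ x, f x ≠ 0) : (fun x => (f x)⁻¹) ∈ regularFunctions c := by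
  obtain ⟨p, q, hq, h⟩ := hf
  refine ⟨q, p, fun x => ?_, fun x => ?_⟩
  · rw [← h]
    exact mul_ne_zero (hq x) (h0 x)
  · rw [← h, mul_assoc, mul_inv_cancel₀ (h0 x), mul_one]

theorem eval_mem (A : Subalgebra k (X → k)) {φ : X → κ → k} (hφ : ∀ j, (fun x => φ x j) ∈ A)
    (p : MvPolynomial κ k) : (fun x => MvPolynomial.eval (φ x) p) ∈ A := by
  induction p using MvPolynomial.induction_on with
  | C a => simpa using const_mem A a
  | add p q hp hq =>
    simp only [map_add]
    exact A.add_mem hp hq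
  | mul_X p j hp =>
    simp only [map_mul, MvPolynomial.eval_X]
    exact A.mul_mem hp (hφ j)

theorem comp_mem_regularFunctions {c : X → ι → k} {c' : Y → κ → k} {φ : X → Y}
    (hφ : ∀ j, (fun x => c' (φ x) j) ∈ regularFunctions c) {f : Y → k}
    (hf : f ∈ regularFunctions c') : (fun x => f (φ x)) ∈ regularFunctions c := by
  obtain ⟨p, q, hq, h⟩ := hf
  have e : (fun x => f (φ x)) = (fun x => (MvPolynomial.eval (c' (φ x)) q)⁻¹) *
      fun x => MvPolynomial.eval (c' (φ x)) p := by
    funext x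
    simp only [Pi.mul_apply]
    rw [← h, inv_mul_cancel_left₀ (hq _)]
  rw [e]
  exact mul_mem (inv_mem_regularFunctions (eval_mem _ hφ q) fun x => hq _) (eval_mem _ hφ p)

theorem isClosed_affineZariski_iff {Z : Set (ι → k)} :
    IsClosed[affineZariski k ι] Z ↔
      ∃ S : Set (MvPolynomial ι k), Z = {x | ∀ p ∈ S, MvPolynomial.eval x p = 0} := by
  rw [← @isOpen_compl_iff _ _ (affineZariski k ι)]
  change Zᶜᶜ ∈ _ ↔ _
  rw [compl_compl]
  rfl

theorem isClosed_induced_affineZariski_iff {c : X → ι → k} {Z : Set X} :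
    IsClosed[(affineZariski k ι).induced c] Z ↔
      ∃ S : Set (MvPolynomial ι k), Z = {x | ∀ p ∈ S, MvPolynomial.eval (c x) p = 0} := by
  let := affineZariski k ι
  rw [isClosed_induced_iff]
  constructor
  · rintro ⟨Z, hZ, rfl⟩
    obtain ⟨S, rfl⟩ := isClosed_affineZariski_iff.mp hZ
    exact ⟨S, rfl⟩
  · rintro ⟨S, rfl⟩
    exact ⟨_, isClosed_affineZariski_iff.mpr ⟨S, rfl⟩, rfl⟩

theorem isClosed_eq_zero {c : X → ι → k} {f : X → k} (hf : f ∈ regularFunctions c) :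
    IsClosed[(affineZariski k ι).induced c] {x | f x = 0} := by
  obtain ⟨p, q, hq, h⟩ := hf
  refine isClosed_induced_affineZariski_iff.mpr ⟨{p}, ?_⟩
  ext x
  simp [← h, hq]

theorem isOpen_ne_zero {c : X → ι → k} {f : X → k} (hf : f ∈ regularFunctions c) :
    IsOpen[(affineZariski k ι).induced c] {x | f x ≠ 0} := by
  let := (affineZariski k ι).induced c
  exact (isClosed_eq_zero hf).isOpen_compl

/-- Polynomials pull back to regular functions, and clearing a nowhere vanishing denominator makes
their zero sets closed. -/
theorem continuous_of_coord_mem {c : X → ι → k} {c' : Y → κ → k} {φ : X → Y}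
    (hφ : ∀ j, (fun x => c' (φ x) j) ∈ regularFunctions c) :
    Continuous[(affineZariski k ι).induced c, (affineZariski k κ).induced c'] φ := by
  let := (affineZariski k ι).induced c
  let := (affineZariski k κ).induced c'
  refine continuous_iff_isClosed.mpr fun Z hZ => ?_
  obtain ⟨S, rfl⟩ := isClosed_induced_affineZariski_iff.mp hZ
  have e : φ ⁻¹' {x | ∀ p ∈ S, MvPolynomial.eval (c' x) p = 0} =
      ⋂ p ∈ S, {x | MvPolynomial.eval (c' (φ x)) p = 0} := by
    ext x
    simp
  rw [e]
  exact isClosed_biInter fun p _ => isClosed_eq_zero (eval_mem _ hφ p)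

/-- On a nonempty basic open subset of affine space the product of two regular functions vanishes
only if one of them does. -/
theorem eq_zero_or_eq_zero_of_mul_regularFunctions [Infinite k] (δ : MvPolynomial ι k)
    {f g : {x : ι → k // MvPolynomial.eval x δ ≠ 0} → k}
    (hf : f ∈ regularFunctions fun x => x.1) (hg : g ∈ regularFunctions fun x => x.1)
    (h : ∀ x, f x * g x = 0) : (∀ x, f x = 0) ∨ ∀ x, g x = 0 := by
  obtain ⟨p, q, hq, hp⟩ := hf
  obtain ⟨p', q', hq', hp'⟩ := hg
  -- The factor `δ` makes the product vanish on all of affine space, where a polynomial over an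
  -- infinite field is determined by its values.
  have h0 : δ * (p * p') = 0 := by
    apply MvPolynomial.funext
    intro x
    by_cases hx : MvPolynomial.eval x δ = 0
    · simp [hx]
    · have := h ⟨x, hx⟩
      have h1 := hp ⟨x, hx⟩
      have h2 := hp' ⟨x, hx⟩
      simp only at h1 h2
      rw [map_mul, map_mul, ← h1, ← h2, map_zero]
      linear_combination MvPolynomial.eval x δ * MvPolynomial.eval x q *
        MvPolynomial.eval x q' * this
  rcases mul_eq_zero.mp h0 with h0 | h0
  -- If `δ = 0`, the basic open set is empty.
  · exact Or.inl fun x => absurd (by simp [h0]) x.2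
  rcases mul_eq_zero.mp h0 with h0 | h0
  · exact Or.inl fun x => by simpa [h0, hq] using hp x
  · exact Or.inr fun x => by simpa [h0, hq'] using hp' x

/-! ### Matrices with regular entries -/

section Matrix

variable {l m n : Type*} [Fintype m] (A : Subalgebra k (X → k))

theorem mul_entry_mem {M : X → Matrix l m k} {N : X → Matrix m n k}
    (hM : ∀ a b, (fun x => M x a b) ∈ A) (hN : ∀ a b, (fun x => N x a b) ∈ A) (a : l) (b : n) :
    (fun x => (M x * N x) a b) ∈ A := by
  have e : (fun x => (M x * N x) a b) = ∑ c, (fun x => M x a c) * fun x => N x c b := by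
    funext x
    simp [Matrix.mul_apply]
  rw [e]
  exact sum_mem fun c _ => mul_mem (hM a c) (hN c b)

variable [DecidableEq m]

theorem det_mem {M : X → Matrix m m k} (hM : ∀ a b, (fun x => M x a b) ∈ A) :
    (fun x => (M x).det) ∈ A := by
  have e : (fun x => (M x).det) =
      ∑ σ : Equiv.Perm m, Equiv.Perm.sign σ • ∏ i, fun x => M x (σ i) i := by
    funext x
    simp [Matrix.det_apply]
  rw [e]
  exact sum_mem fun σ _ => zsmul_mem (prod_mem fun i _ => hM _ _) _

theorem adjugate_entry_mem {M : X → Matrix m m k} (hM : ∀ a b, (fun x => M x a b) ∈ A) (a b : m) :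
    (fun x => (M x).adjugate a b) ∈ A := by
  simp only [Matrix.adjugate_apply]
  refine det_mem A fun i j => ?_
  by_cases hi : i = b
  · simpa [hi] using const_mem A _
  · simpa [hi] using hM i j

/-- The inverse is the adjugate over the determinant; this is where denominators are needed in
`regularFunctions`. -/
theorem units_inv_entry_mem {c : X → ι → k} {g : X → GL m k}
    (hg : ∀ a b, (fun x => (g x).val a b) ∈ regularFunctions c) (a b : m) :
    (fun x => ((g x)⁻¹ : GL m k).val a b) ∈ regularFunctions c := by
  have e : (fun x => ((g x)⁻¹ : GL m k).val a b) =
      (fun x => ((g x).val.det)⁻¹) * fun x => (g x).val.adjugate a b := by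
    funext x
    rw [Matrix.coe_units_inv, Matrix.inv_def, Ring.inverse_eq_inv']
    rfl
  rw [e]
  refine mul_mem (inv_mem_regularFunctions (det_mem _ hg) fun x => ?_) (adjugate_entry_mem _ hg a b)
  exact ((Matrix.isUnit_iff_isUnit_det _).mp (g x).isUnit).ne_zero

end Matrix

/-- Local solutions of a family of homogeneous linear systems: a solution `x₀` at the parameter `M`
extends, up to a scalar, to a family of solutions over all parameters with a solution space of the
same dimension. -/
theorem exists_family_of_mem_ker {E T : Type*} [AddCommGroup E] [Module k E] [AddCommGroup T]
    [Module k T] [FiniteDimensional k E] (A : Subalgebra k (X → k)) (L : X → E →ₗ[k] T)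
    (hL : ∀ (x : E) (l : T →ₗ[k] k), (fun N => l (L N x)) ∈ A) (M : X) {x₀ : E}
    (hx₀ : L M x₀ = 0) :
    ∃ γ : X → E, (∀ l : E →ₗ[k] k, (fun N => l (γ N)) ∈ A) ∧ γ M = x₀ ∧
      ∀ N, Module.finrank k (LinearMap.ker (L N)) = Module.finrank k (LinearMap.ker (L M)) →
        L N (γ N) = 0 := by
  obtain ⟨C, hC⟩ := Submodule.exists_isCompl (LinearMap.ker (L M))
  let e := (Module.finBasis k C).equivFun
  let i : (Fin (Module.finrank k C) → k) →ₗ[k] E := C.subtype ∘ₗ e.symm.toLinearMap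
  have hi : LinearMap.ker (L M ∘ₗ i) = ⊥ := by
    rw [LinearMap.ker_eq_bot']
    intro y hy
    have : (e.symm y : E) ∈ LinearMap.ker (L M) ⊓ C := ⟨hy, (e.symm y).2⟩
    rw [hC.inf_eq_bot, Submodule.mem_bot] at this
    simpa using this
  obtain ⟨ρ, hρ⟩ := (L M ∘ₗ i).exists_leftInverse_of_injective hi
  -- The square block of `L N` that is the identity at `M`: restricted to a complement of the kernel
  -- at `M` and followed by a left inverse of `L M` there.
  let B : X → Matrix _ _ k := fun N => LinearMap.toMatrix' (ρ ∘ₗ L N ∘ₗ i)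
  have hB : ∀ a b, (fun N => B N a b) ∈ A := fun a b => by
    simpa [B, LinearMap.toMatrix'_apply] using
      hL (i (Pi.single b 1)) (LinearMap.proj a ∘ₗ ρ)
  have hBM : B M = 1 := by
    simp only [B]
    rw [hρ, LinearMap.toMatrix'_id]
  have hmul : ∀ N y, (B N).mulVec y = ρ (L N (i y)) := fun N y => by
    simp only [B]
    rw [LinearMap.toMatrix'_mulVec]
    rfl
  -- Cramer's rule: `B v = det B • ρ (L N x₀)`, so `det B • x₀ - i v` is killed by `ρ ∘ L N`.
  let v : X → Fin (Module.finrank k C) → k := fun N => (B N).adjugate.mulVec (ρ (L N x₀))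
  have hv : ∀ a, (fun N => v N a) ∈ A := fun a => by
    have e : (fun N => v N a) =
        ∑ b, (fun N => (B N).adjugate a b) * fun N => (LinearMap.proj b ∘ₗ ρ) (L N x₀) := by
      funext N
      simp [v, Matrix.mulVec, dotProduct]
    rw [e]
    exact sum_mem fun b _ => mul_mem (adjugate_entry_mem A hB a b) (hL _ _)
  have hρv : ∀ N, ρ (L N ((B N).det • x₀ - i (v N))) = 0 := fun N => by
    rw [map_sub, map_sub, ← hmul, map_smul, map_smul, Matrix.mulVec_mulVec, Matrix.mul_adjugate,
      Matrix.smul_mulVec, Matrix.one_mulVec, sub_self]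
  -- The additional factor `det B` makes the family vanish where `B` is singular, so that no
  -- condition remains there.
  refine ⟨fun N => (B N).det • ((B N).det • x₀ - i (v N)), fun l => ?_, ?_, fun N hN => ?_⟩
  · have e : (fun N => l ((B N).det • ((B N).det • x₀ - i (v N)))) =
        (fun N => (B N).det) * ((fun N => (B N).det) * (fun _ => l x₀) -
          ∑ a, (fun N => v N a) * fun _ => l (i fun j => if a = j then 1 else 0)) := by
      funext N
      have := LinearMap.pi_apply_eq_sum_univ (l ∘ₗ i) (v N)
      rw [LinearMap.comp_apply] at this
      rw [map_smul, map_sub, map_smul, this]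
      simp only [Pi.mul_apply, Pi.sub_apply, Finset.sum_apply, smul_eq_mul, LinearMap.comp_apply]
    rw [e]
    exact mul_mem (det_mem A hB) (sub_mem (mul_mem (det_mem A hB) (const_mem A _))
      (sum_mem fun a _ => mul_mem (hv a) (const_mem A _)))
  · simp [hBM, v, hx₀]
  · rw [map_smul]
    by_cases h0 : (B N).det = 0
    · rw [h0, zero_smul]
    have hsurj : LinearMap.range (ρ ∘ₗ L N) = ⊤ := by
      rw [LinearMap.range_eq_top]
      intro y
      refine ⟨i ((B N)⁻¹.mulVec y), ?_⟩
      rw [LinearMap.comp_apply, ← hmul, Matrix.mulVec_mulVec,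
        Matrix.mul_nonsing_inv _ (isUnit_iff_ne_zero.mpr h0), Matrix.one_mulVec]
    have h1 := LinearMap.finrank_range_add_finrank_ker (ρ ∘ₗ L N)
    rw [hsurj, finrank_top, Module.finrank_fin_fun] at h1
    have h2 := Submodule.finrank_add_eq_of_isCompl hC
    -- Since `ρ ∘ L N` is onto, its kernel has dimension `dim E - dim C`, that of the kernel at `M`;
    -- by hypothesis this is also the dimension of the smaller space `ker (L N)`.
    have h3 : LinearMap.ker (L N) = LinearMap.ker (ρ ∘ₗ L N) :=
      Submodule.eq_of_le_of_finrank_eq (LinearMap.ker_le_ker_comp _ _) (by omega)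
    have h4 : (B N).det • x₀ - i (v N) ∈ LinearMap.ker (L N) := by
      rw [h3]
      exact hρv N
    rw [LinearMap.mem_ker.mp h4, smul_zero]

end Regular

/-! ### Regular maps into `GL_d` and `rep_d` -/

section GLMaps

open scoped Topology

variable {V : Type*} {k : Type*} [Field k] {d : V → ℕ} {X ι : Type*} {c : X → ι → k}
  {g h : X → GLd k d}

/-- The map `g : X → GL_d` has regular matrix entries. -/
def IsRegularGL (c : X → ι → k) (g : X → GLd k d) : Prop :=
  ∀ i p q, (fun x => (g x i).val p q) ∈ regularFunctions c

theorem isRegularGL_id : IsRegularGL glCoord (fun g : GLd k d => g) :=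
  fun i p q => coord_mem_regularFunctions glCoord ⟨i, p, q⟩

theorem isRegularGL_const (g : GLd k d) : IsRegularGL c (fun _ => g) :=
  fun _ _ _ => const_mem _ _

theorem IsRegularGL.mul (hg : IsRegularGL c g) (hh : IsRegularGL c h) :
    IsRegularGL c (fun x => g x * h x) :=
  fun i p q => mul_entry_mem _ (hg i) (hh i) p q

theorem IsRegularGL.inv (hg : IsRegularGL c g) : IsRegularGL c (fun x => (g x)⁻¹) :=
  fun i p q => units_inv_entry_mem (hg i) p q

theorem IsRegularGL.coord_mem (hg : IsRegularGL c g) (j) :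
    (fun x => glCoord (g x) j) ∈ regularFunctions c :=
  hg j.1 j.2.1 j.2.2

theorem IsRegularGL.continuous (hg : IsRegularGL c g) :
    Continuous[(affineZariski k ι).induced c, inferInstance] g :=
  continuous_of_coord_mem hg.coord_mem

end GLMaps

section RepMaps

open scoped Topology

variable {V : Type*} [Quiver V] {k : Type*} [Field k] {d : V → ℕ} {X ι : Type*}

/-- The map `M : X → rep_d` has regular matrix entries. -/
def IsRegularRep (c : X → ι → k) (M : X → QuiverRep k d) : Prop :=
  ∀ ⦃i j : V⦄ (a : i ⟶ j) p q, (fun x => M x a p q) ∈ regularFunctions c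

/-- The coordinates on `rep_d × GL_d`. -/
def repGLCoord (x : QuiverRep k d × GLd k d) :
    (Σ (i j : V), (i ⟶ j) × Fin (d j) × Fin (d i)) ⊕ (Σ i : V, Fin (d i) × Fin (d i)) → k :=
  Sum.elim (repCoord x.1) (glCoord x.2)

variable {c : X → ι → k} {M : X → QuiverRep k d} {g h : X → GLd k d}

theorem isRegularRep_id : IsRegularRep repCoord (fun M : QuiverRep k d => M) :=
  fun i j a p q => coord_mem_regularFunctions repCoord ⟨i, j, a, p, q⟩

theorem isRegularRep_fst : IsRegularRep repGLCoord (Prod.fst : QuiverRep k d × GLd k d → _) :=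
  fun i j a p q => coord_mem_regularFunctions repGLCoord (Sum.inl ⟨i, j, a, p, q⟩)

theorem isRegularGL_snd : IsRegularGL repGLCoord (Prod.snd : QuiverRep k d × GLd k d → _) :=
  fun i p q => coord_mem_regularFunctions repGLCoord (Sum.inr ⟨i, p, q⟩)

theorem isRegularRep_const (N : QuiverRep k d) : IsRegularRep c (fun _ => N) :=
  fun _ _ _ _ _ => const_mem _ _

theorem IsRegularRep.smul (hg : IsRegularGL c g) (hM : IsRegularRep c M) :
    IsRegularRep c (fun x => g x • M x) :=
  fun i j a p q => mul_entry_mem _ (mul_entry_mem _ (hg j) (hM a)) (hg.inv i) p q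

theorem IsRegularRep.coord_mem (hM : IsRegularRep c M) (j) :
    (fun x => repCoord (M x) j) ∈ regularFunctions c :=
  hM j.2.2.1 j.2.2.2.1 j.2.2.2.2

theorem IsRegularRep.repGLCoord_mem (hM : IsRegularRep c M) (hg : IsRegularGL c g) (j) :
    (fun x => repGLCoord (M x, g x) j) ∈ regularFunctions c := by
  rcases j with j | j
  · exact hM.coord_mem j
  · exact hg.coord_mem j

theorem IsRegularRep.continuous (hM : IsRegularRep c M) :
    Continuous[(affineZariski k ι).induced c, inferInstance] M :=
  continuous_of_coord_mem hM.coord_mem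

theorem IsRegularRep.continuous_prodMk (hM : IsRegularRep c M) (hg : IsRegularGL c g) :
    Continuous[(affineZariski k ι).induced c, zariskiRepGL] (fun x => (M x, g x)) :=
  continuous_of_coord_mem (c' := repGLCoord) (hM.repGLCoord_mem hg)

end RepMaps

section Dense

/-- Reduces density in a subvariety to closed sets of the ambient variety, which can be written down
explicitly. -/
theorem dense_coe_iff {σ X : Type*} [TopologicalSpace X] [SetLike σ X] {S : σ} {D : Set S} :
    Dense D ↔ ∀ C : Set X, IsClosed C → (∀ x ∈ D, (x : X) ∈ C) → ∀ x ∈ S, x ∈ C := by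
  constructor
  · intro hD C hC h x hx
    have h1 : closure D ⊆ Subtype.val ⁻¹' C :=
      closure_minimal h (hC.preimage continuous_subtype_val)
    exact h1 (hD ⟨x, hx⟩)
  · intro h
    rw [dense_iff_closure_eq, Set.eq_univ_iff_forall]
    obtain ⟨C, hC, e⟩ := isClosed_induced_iff.mp (isClosed_closure (s := D))
    intro x
    rw [← e]
    refine h C hC (fun y hy => ?_) x.1 x.2
    have := subset_closure hy
    rwa [← e] at this

end Dense

/-! ### Orbits in `R_dd` and in the incidence variety (1 ⇔ 2) -/

section Incidence

open scoped Topology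

variable {V : Type*} [Quiver V] {k : Type*} [Field k] {d : V → ℕ} {s : ℕ}
  {dd : DimFiltration d s} {F : GradedFlag k dd}

/-- The point `(M, gP)` of `rep_d × GL_d/P`. -/
def RepProdFlag.mkCoset (F : GradedFlag k dd) (x : QuiverRep k d × GLd k d) : RepProdFlag F :=
  ⟨x.1, (x.2 : GLd k d ⧸ parabolic F)⟩

theorem RepProdFlag.mkCoset_surjective : Function.Surjective (RepProdFlag.mkCoset F) := by
  rintro ⟨M, U⟩
  obtain ⟨g, rfl⟩ := QuotientGroup.mk_surjective U
  exact ⟨(M, g), rfl⟩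

theorem RepProdFlag.isClosed_iff {C : Set (RepProdFlag F)} :
    IsClosed C ↔ IsClosed[zariskiRepGL] (RepProdFlag.mkCoset F ⁻¹' C) :=
  isClosed_coinduced

theorem RepProdFlag.continuous_mkCoset :
    Continuous[zariskiRepGL, inferInstance] (RepProdFlag.mkCoset F) :=
  continuous_coinduced_rng

theorem IsRegularRep.continuous_mkCoset {X ι : Type*} {c : X → ι → k} {M : X → QuiverRep k d}
    {g : X → GLd k d} (hM : IsRegularRep c M) (hg : IsRegularGL c g) :
    Continuous[(affineZariski k ι).induced c, inferInstance]
      (fun x => RepProdFlag.mkCoset F (M x, g x)) := by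
  let := (affineZariski k ι).induced c
  exact @Continuous.comp _ _ _ _ zariskiRepGL _ _ _ RepProdFlag.continuous_mkCoset
    (hM.continuous_prodMk hg)

theorem RepProdFlag.mkCoset_eq_mkCoset {M : QuiverRep k d} {g h : GLd k d}
    (e : (g : GLd k d ⧸ parabolic F) = h) : mkCoset F (M, g) = mkCoset F (M, h) :=
  RepProdFlag.ext rfl e

theorem RepProdFlag.smul_mkCoset (g : GLd k d) (x : QuiverRep k d × GLd k d) :
    g • RepProdFlag.mkCoset F x = RepProdFlag.mkCoset F (g • x.1, g * x.2) :=
  rfl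

theorem Lowers.smul_iff {M : QuiverRep k d} (g : GLd k d)
    {U : ∀ i : V, Fin (s + 1) → Submodule k (Fin (d i) → k)} :
    Lowers (g • M) (fun i t => translate g i (U i t)) ↔ Lowers M U := by
  refine ⟨fun h => ?_, fun h => h.smul g⟩
  have := h.smul g⁻¹
  simp only [← translate_mul, inv_mul_cancel, translate_one, inv_smul_smul] at this
  exact this

/-- Translation by `g⁻¹` carries the flag `gF` back to `F`. -/
theorem lowers_cosetFlag_iff {M : QuiverRep k d} {g : GLd k d} :
    Lowers M (cosetFlag F (g : GLd k d ⧸ parabolic F)) ↔ g⁻¹ • M ∈ repFlag F := by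
  have h := Lowers.smul_iff (M := g⁻¹ • M) g (U := F.space)
  rw [smul_inv_smul] at h
  exact h

theorem mkCoset_mem_incidence {M : QuiverRep k d} {g : GLd k d} :
    RepProdFlag.mkCoset F (M, g) ∈ incidence F ↔ g⁻¹ • M ∈ repFlag F :=
  lowers_cosetFlag_iff

theorem mem_collapseImage_iff {M : QuiverRep k d} :
    M ∈ collapseImage F ↔ ∃ g : GLd k d, g⁻¹ • M ∈ repFlag F := by
  constructor
  · rintro ⟨y, rfl⟩
    induction y using Quotient.inductionOn with
    | h y =>
      refine ⟨y.1, ?_⟩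
      change y.1⁻¹ • y.1 • (y.2 : QuiverRep k d) ∈ repFlag F
      rw [inv_smul_smul]
      exact y.2.2
  · rintro ⟨g, hg⟩
    exact ⟨Quotient.mk (bundleSetoid F) (g, ⟨_, hg⟩), smul_inv_smul g M⟩

theorem hasDenseOrbit_incidence_of_repFlag (h : HasDenseOrbit (parabolic F) (repFlag F)) :
    HasDenseOrbit (GLd k d) (incidence F) := by
  obtain ⟨x, hx⟩ := h
  have hx' := dense_coe_iff.mp hx
  refine ⟨⟨RepProdFlag.mkCoset F (x, 1), mkCoset_mem_incidence.mpr ?_⟩, ?_⟩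
  · simp
  refine dense_coe_iff.mpr fun C hC hsub => ?_
  intro y hy
  obtain ⟨⟨M, g⟩, rfl⟩ := RepProdFlag.mkCoset_surjective y
  have hM := mkCoset_mem_incidence.mp hy
  -- The map `r ↦ (g • r, gP)` carries `repFlag F` onto the slice of the incidence variety over
  -- `gP`.
  have hcont : Continuous (fun r : QuiverRep k d => RepProdFlag.mkCoset F (g • r, g)) :=
    (isRegularRep_id.smul (isRegularGL_const g)).continuous_mkCoset (isRegularGL_const g)
  have := hx' _ (hC.preimage hcont) ?_ _ hM
  · simpa using this
  · rintro _ ⟨p, rfl⟩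
    have := hsub _ ⟨g * p, rfl⟩
    have e : (g * p.1) • RepProdFlag.mkCoset F ((x : QuiverRep k d), 1) =
        RepProdFlag.mkCoset F (g • p.1 • (x : QuiverRep k d), g) := by
      rw [RepProdFlag.smul_mkCoset]
      simp only [mul_smul, mul_one]
      refine RepProdFlag.mkCoset_eq_mkCoset (QuotientGroup.eq.mpr ?_)
      simp
    change (g * p.1) • RepProdFlag.mkCoset F ((x : QuiverRep k d), 1) ∈ C at this
    rwa [e] at this

theorem hasDenseOrbit_repFlag_of_incidence (h : HasDenseOrbit (GLd k d) (incidence F)) :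
    HasDenseOrbit (parabolic F) (repFlag F) := by
  obtain ⟨x, hd⟩ := h
  have hd' := dense_coe_iff.mp hd
  obtain ⟨⟨M, g⟩, hx⟩ := RepProdFlag.mkCoset_surjective x.1
  have hy : RepProdFlag.mkCoset F (M, g) ∈ incidence F := hx ▸ x.2
  refine ⟨⟨g⁻¹ • M, mkCoset_mem_incidence.mp hy⟩, ?_⟩
  refine dense_coe_iff.mpr fun Z hZ hsub => ?_
  -- the largest subset of `Z` which is stable under the parabolic
  let C : Set (RepProdFlag F) := {y | ∀ h : GLd k d, (h : GLd k d ⧸ parabolic F) = y.flag →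
    h⁻¹ • y.rep ∈ Z}
  have hC : IsClosed C := by
    rw [RepProdFlag.isClosed_iff]
    -- The representatives of a coset are the `x.2 * p`, so `C` pulls back to an intersection of
    -- preimages of `Z` under regular maps.
    have e : RepProdFlag.mkCoset F ⁻¹' C =
        ⋂ p : parabolic F, (fun x : QuiverRep k d × GLd k d => (x.2 * p)⁻¹ • x.1) ⁻¹' Z := by
      ext x
      simp only [Set.mem_preimage, Set.mem_iInter]
      constructor
      · intro hx p
        exact hx (x.2 * p) (QuotientGroup.eq.mpr (by simp))
      · intro hx h hh
        change h⁻¹ • x.1 ∈ Z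
        have := hx ⟨x.2⁻¹ * h, QuotientGroup.eq.mp hh.symm⟩
        simpa using this
    rw [e]
    exact @isClosed_iInter _ _ zariskiRepGL _ fun p =>
      @IsClosed.preimage _ _ zariskiRepGL _ _ (IsRegularRep.continuous
        (isRegularRep_fst.smul (isRegularGL_snd.mul (isRegularGL_const p.1)).inv)) _ hZ
  have hIC := hd' C hC ?_
  · intro r hr
    have : (1 : GLd k d)⁻¹ • r ∈ Z := hIC (RepProdFlag.mkCoset F (r, 1))
      (mkCoset_mem_incidence.mpr (by simpa using hr)) 1 rfl
    simpa using this
  · rintro _ ⟨a, rfl⟩ h hh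
    change _ = (a • x.1).flag at hh
    change h⁻¹ • (a • x.1).rep ∈ Z
    rw [← hx] at hh ⊢
    change (h : GLd k d ⧸ parabolic F) = ((a * g : GLd k d) : GLd k d ⧸ parabolic F) at hh
    change h⁻¹ • a • M ∈ Z
    have hp := QuotientGroup.eq.mp hh
    have := hsub _ ⟨⟨_, hp⟩, rfl⟩
    change (h⁻¹ * (a * g)) • g⁻¹ • M ∈ Z at this
    simpa [mul_smul] using this

end Incidence

/-! ### Local sections of orbit maps -/

section Section

open scoped Topology

variable {V : Type*} [Quiver V] {k : Type*} [Field k] {d : V → ℕ}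

theorem isOpen_image_subtype_val {X ι : Type*} {c : X → ι → k} {D : X → k}
    (hD : D ∈ regularFunctions c) {U : Set {x // D x ≠ 0}}
    (hU : IsOpen[(affineZariski k ι).induced fun x => c x.1] U) :
    IsOpen[(affineZariski k ι).induced c] (Subtype.val '' U) := by
  let := (affineZariski k ι).induced c
  have e : (affineZariski k ι).induced (fun x : {x // D x ≠ 0} => c x.1) =
      instTopologicalSpaceSubtype := induced_compose.symm
  rw [e] at hU
  exact (isOpen_ne_zero hD).isOpenMap_subtype_val _ hU

theorem mem_autQ_iff {M : QuiverRep k d} {g : GLd k d} : g ∈ autQ M ↔ g • M = M := by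
  refine ⟨smul_eq_of_mem_autQ, fun h i j a => ?_⟩
  have h1 : (g j).val * M a * ((g i)⁻¹ : GL _ k).val = M a :=
    congr_fun (congr_fun (congr_fun h i) j) a
  conv_rhs => rw [← h1]
  rw [Matrix.mul_assoc _ _ (g i).val, Units.inv_mul, Matrix.mul_one]

/-- The linear map `x ↦ x M - N x`, whose kernel is `Hom_Q(M, N)`. -/
def homDefect (M N : QuiverRep k d) : (∀ i, Matrix (Fin (d i)) (Fin (d i)) k) →ₗ[k]
    ((Σ (i j : V), (i ⟶ j) × Fin (d j) × Fin (d i)) → k) where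
  toFun x := repCoord fun i j a => x j * M a - N a * x i
  map_add' x y := by
    funext c
    simp only [repCoord, Pi.add_apply, Matrix.add_mul, Matrix.mul_add, Matrix.sub_apply,
      Matrix.add_apply]
    ring
  map_smul' r x := by
    funext c
    simp only [repCoord, Pi.smul_apply, Matrix.smul_mul, Matrix.mul_smul, Matrix.sub_apply,
      Matrix.smul_apply, RingHom.id_apply, smul_sub]

theorem homDefect_eq_zero_iff {M N : QuiverRep k d} {x : ∀ i, Matrix (Fin (d i)) (Fin (d i)) k} :
    homDefect M N x = 0 ↔ ∀ ⦃i j : V⦄ (a : i ⟶ j), x j * M a = N a * x i := by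
  constructor
  · intro h i j a
    ext p q
    exact sub_eq_zero.mp (congr_fun h ⟨i, j, a, p, q⟩)
  · intro h
    funext ⟨i, j, a, p, q⟩
    change (x j * M a - N a * x i) p q = 0
    rw [h a, sub_self]
    rfl

/-- Composition with the isomorphism `g : N → g • N` identifies `Hom_Q(M, N)` with `Hom_Q(M, g •
N)`. This supplies the constant dimension required by `exists_family_of_mem_ker`. -/
theorem finrank_ker_homDefect_smul (M N : QuiverRep k d) (g : GLd k d) :
    Module.finrank k (LinearMap.ker (homDefect M (g • N))) =
      Module.finrank k (LinearMap.ker (homDefect M N)) := by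
  let e : (∀ i, Matrix (Fin (d i)) (Fin (d i)) k) ≃ₗ[k] ∀ i, Matrix (Fin (d i)) (Fin (d i)) k :=
    { toFun := fun x i => (g i).val * x i
      invFun := fun x i => ((g i)⁻¹ : GL _ k).val * x i
      map_add' := fun x y => by
        funext i
        exact Matrix.mul_add _ _ _
      map_smul' := fun r x => by
        funext i
        exact Matrix.mul_smul (g i).val r (x i)
      left_inv := fun x => by
        funext i
        simp only [← Matrix.mul_assoc, Units.inv_mul, Matrix.one_mul]
      right_inv := fun x => by
        funext i
        simp only [← Matrix.mul_assoc, Units.mul_inv, Matrix.one_mul] }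
  have h : LinearMap.ker (homDefect M (g • N)) =
      (LinearMap.ker (homDefect M N)).map e.toLinearMap := by
    ext y
    obtain ⟨x, rfl⟩ := e.surjective y
    have : e x ∈ (LinearMap.ker (homDefect M N)).map e.toLinearMap ↔
        x ∈ LinearMap.ker (homDefect M N) :=
      e.injective.mem_set_image
    rw [this, LinearMap.mem_ker, LinearMap.mem_ker, homDefect_eq_zero_iff, homDefect_eq_zero_iff]
    refine forall₃_congr fun i j a => ?_
    change (g j).val * x j * M a = (g j).val * N a * ((g i)⁻¹ : GL _ k).val * ((g i).val * x i) ↔ _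
    rw [Matrix.mul_assoc _ _ ((g i).val * x i), ← Matrix.mul_assoc _ (g i).val, Units.inv_mul,
      Matrix.one_mul, Matrix.mul_assoc, Matrix.mul_assoc]
    refine ⟨fun h => ?_, fun h => by rw [h]⟩
    have h' := congr_arg (((g j)⁻¹ : GL _ k).val * ·) h
    simpa only [← Matrix.mul_assoc, Units.inv_mul, Matrix.one_mul] using h'
  rw [h]
  exact LinearEquiv.finrank_map_eq e _

variable [Finite V] [∀ i j : V, Finite (i ⟶ j)]

/-- The identity of `M` is extended to nearby `N`. The intertwining equations hold on the orbit,
where the dimension of `Hom_Q(M, N)` is constant, and persist on its closure because they are closed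
conditions on `N`. -/
theorem exists_regular_intertwiner (M : QuiverRep k d) :
    ∃ γ : QuiverRep k d → ∀ i, Matrix (Fin (d i)) (Fin (d i)) k,
      (∀ i p q, (fun N => γ N i p q) ∈ regularFunctions repCoord) ∧ γ M = (fun _ => 1) ∧
      ∀ N ∈ closure (MulAction.orbit (GLd k d) M), ∀ ⦃i j : V⦄ (a : i ⟶ j),
        γ N j * M a = N a * γ N i := by
  have := Fintype.ofFinite (Σ (i j : V), (i ⟶ j) × Fin (d j) × Fin (d i))
  have entry_mem : ∀ γ : QuiverRep k d → ∀ i, Matrix (Fin (d i)) (Fin (d i)) k,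
      (∀ i p q, (fun N => γ N i p q) ∈ regularFunctions repCoord) → ∀ c,
      (fun N => homDefect M N (γ N) c) ∈ regularFunctions repCoord := by
    rintro γ hγ ⟨i, j, a, p, q⟩
    exact sub_mem (mul_entry_mem _ (hγ j) (isRegularRep_const M a) p q)
      (mul_entry_mem _ (isRegularRep_id a) (hγ i) p q)
  obtain ⟨γ, hγ, hγM, hker⟩ := exists_family_of_mem_ker (regularFunctions repCoord)
    (homDefect M) (fun x l => by
      classical
      have e : (fun N => l (homDefect M N x)) =
          ∑ c, (fun N => homDefect M N x c) * fun _ => l fun b => if c = b then 1 else 0 := by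
        funext N
        rw [LinearMap.pi_apply_eq_sum_univ l]
        simp only [Finset.sum_apply, Pi.mul_apply, smul_eq_mul]
      rw [e]
      exact sum_mem fun c _ => mul_mem (entry_mem (fun _ => x) (fun i p q => const_mem _ _) c)
        (const_mem _ _)) M (x₀ := fun _ => 1)
    (homDefect_eq_zero_iff.mpr fun i j a => by rw [Matrix.one_mul, Matrix.mul_one])
  have hγ' : ∀ i p q, (fun N => γ N i p q) ∈ regularFunctions repCoord := fun i p q =>
    hγ (Matrix.entryLinearMap k k p q ∘ₗ LinearMap.proj i)
  refine ⟨γ, hγ', hγM, fun N hN => ?_⟩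
  rw [← homDefect_eq_zero_iff]
  funext c
  refine closure_minimal ?_ (isClosed_eq_zero (entry_mem γ hγ' c)) hN
  rintro _ ⟨g, rfl⟩
  exact congr_fun (hker _ (finrank_ker_homDefect_smul M M g)) c

/-- Near `M` the orbit map `g ↦ g • M` has a regular section over the closure of the orbit. -/
theorem exists_local_section (M : QuiverRep k d) :
    ∃ D ∈ regularFunctions (repCoord (k := k) (d := d)), ∃ hM : D M ≠ 0,
      ∃ g : {N // D N ≠ 0} → GLd k d, IsRegularGL (fun N => repCoord N.1) g ∧ g ⟨M, hM⟩ = 1 ∧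
        ∀ N, N.1 ∈ closure (MulAction.orbit (GLd k d) M) → g N • M = N.1 := by
  have := Fintype.ofFinite V
  obtain ⟨γ, hγ, hγM, h⟩ := exists_regular_intertwiner M
  have hdet : ∀ N : {N // ∏ i, (γ N i).det ≠ 0}, ∀ i, (γ N.1 i).det ≠ 0 := fun N i =>
    Finset.prod_ne_zero_iff.mp N.2 i (Finset.mem_univ i)
  refine ⟨fun N => ∏ i, (γ N i).det, ?_, by simp [hγM],
    fun N i => Matrix.GeneralLinearGroup.mkOfDetNeZero (γ N.1 i) (hdet N i), ?_, ?_, ?_⟩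
  · have e : (fun N => ∏ i, (γ N i).det) = ∏ i, fun N => (γ N i).det := by
      funext N
      rw [Finset.prod_apply]
    rw [e]
    exact prod_mem fun i _ => det_mem _ (hγ i)
  · intro i p q
    exact comp_mem_regularFunctions (φ := Subtype.val)
      (fun j => coord_mem_regularFunctions (fun N : {N // ∏ i, (γ N i).det ≠ 0} => repCoord N.1) j)
      (hγ i p q)
  · funext i
    apply Units.ext
    change γ M i = 1
    rw [hγM]
  · intro N hN
    funext i j a
    change γ N.1 j * M a * ((Matrix.GeneralLinearGroup.mkOfDetNeZero (γ N.1 i) (hdet N i))⁻¹).val = _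
    rw [h N.1 hN a]
    change N.1 a * (Matrix.GeneralLinearGroup.mkOfDetNeZero (γ N.1 i) (hdet N i)).val * _ = _
    rw [Matrix.mul_assoc, Units.mul_inv, Matrix.mul_one]

end Section

/-- The line through two points of `GL_d`, as a regular map on a basic open subset of the affine
line. -/
theorem exists_regularGL_line {V : Type*} [Finite V] {k : Type*} [Field k] {d : V → ℕ}
    (g h : GLd k d) :
    ∃ δ : MvPolynomial Unit k, ∃ l : {t : Unit → k // MvPolynomial.eval t δ ≠ 0} → GLd k d,
      IsRegularGL (fun t => t.1) l ∧ (∃ t, t.1 () = 0 ∧ l t = g) ∧ ∃ t, t.1 () = 1 ∧ l t = h := by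
  have := Fintype.ofFinite V
  let L : (Unit → k) → ∀ i, Matrix (Fin (d i)) (Fin (d i)) k := fun t i =>
    (1 - t ()) • (g i).val + t () • (h i).val
  -- The product of the determinants of the segment `(1 - t) g + t h`, as a polynomial in `t`; it is
  -- nonzero at `0` and `1`.
  let δ : MvPolynomial Unit k := ∏ i, Matrix.det (((1 : MvPolynomial Unit k) - MvPolynomial.X ()) •
    (g i).val.map (MvPolynomial.C (σ := Unit)) +
      (MvPolynomial.X () : MvPolynomial Unit k) • (h i).val.map (MvPolynomial.C (σ := Unit)))
  have hδ : ∀ t, MvPolynomial.eval t δ = ∏ i, (L t i).det := fun t => by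
    rw [map_prod]
    refine Finset.prod_congr rfl fun i _ => ?_
    rw [RingHom.map_det]
    congr 1
    ext p q
    simp [L]
  have hdet : ∀ t : {t : Unit → k // MvPolynomial.eval t δ ≠ 0}, ∀ i, (L t.1 i).det ≠ 0 :=
    fun t i => Finset.prod_ne_zero_iff.mp (hδ t.1 ▸ t.2) i (Finset.mem_univ i)
  have hunit : ∀ (a : GLd k d) i, (a i).val.det ≠ 0 := fun a i =>
    ((Matrix.isUnit_iff_isUnit_det _).mp (a i).isUnit).ne_zero
  have h0 : L (fun _ => 0) = fun i => (g i).val := by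
    funext i
    simp [L]
  have h1 : L (fun _ => 1) = fun i => (h i).val := by
    funext i
    simp [L]
  refine ⟨δ, fun t i => Matrix.GeneralLinearGroup.mkOfDetNeZero (L t.1 i) (hdet t i), ?_,
    ⟨⟨fun _ => 0, ?_⟩, rfl, ?_⟩, ⟨⟨fun _ => 1, ?_⟩, rfl, ?_⟩⟩
  · intro i p q
    have ht := coord_mem_regularFunctions
      (fun t : {t : Unit → k // MvPolynomial.eval t δ ≠ 0} => t.1) ()
    exact add_mem (mul_mem (sub_mem (const_mem _ 1) ht) (const_mem _ ((g i).val p q)))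
      (mul_mem ht (const_mem _ ((h i).val p q)))
  · rw [hδ, h0]
    exact Finset.prod_ne_zero_iff.mpr fun i _ => hunit g i
  · funext i
    exact Units.ext (congr_fun h0 i)
  · rw [hδ, h1]
    exact Finset.prod_ne_zero_iff.mpr fun i _ => hunit h i
  · funext i
    exact Units.ext (congr_fun h1 i)

/-! ### The collapsing map and its fibres (2 ⇔ 3) -/

section Collapse

open scoped Topology

variable {V : Type*} [Quiver V] {k : Type*} [Field k] {d : V → ℕ} {s : ℕ}
  {dd : DimFiltration d s} {F : GradedFlag k dd}

theorem rep_mem_collapseImage {y : RepProdFlag F} (hy : y ∈ incidence F) :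
    y.rep ∈ collapseImage F := by
  obtain ⟨⟨M, g⟩, rfl⟩ := RepProdFlag.mkCoset_surjective y
  exact mem_collapseImage_iff.mpr ⟨g, mkCoset_mem_incidence.mp hy⟩

/-- The projection to `rep_d` is continuous and equivariant, and maps the incidence variety onto the
image of `π_dd`. -/
theorem dense_orbit_rep {x : incidence F} (hx : Dense (MulAction.orbit (GLd k d) x)) :
    Dense (MulAction.orbit (GLd k d)
      (⟨x.1.rep, rep_mem_collapseImage x.2⟩ : collapseImage F)) := by
  refine dense_coe_iff.mpr fun C hC hsub M hM => ?_
  obtain ⟨g, hg⟩ := mem_collapseImage_iff.mp hM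
  have hC' : IsClosed ((fun y : RepProdFlag F => y.rep) ⁻¹' C) := by
    rw [RepProdFlag.isClosed_iff]
    exact @IsClosed.preimage _ _ zariskiRepGL _ _ isRegularRep_fst.continuous _ hC
  refine dense_coe_iff.mp hx _ hC' ?_ (RepProdFlag.mkCoset F (M, g)) (mkCoset_mem_incidence.mpr hg)
  rintro _ ⟨a, rfl⟩
  exact hsub _ ⟨a, rfl⟩

theorem repFlag_convex {M N : QuiverRep k d} (hM : M ∈ repFlag F) (hN : N ∈ repFlag F) (a b : k) :
    (fun _ _ f => a • M f + b • N f : QuiverRep k d) ∈ repFlag F := by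
  intro i j f t x hx
  change (a • M f + b • N f).mulVec x ∈ _
  rw [Matrix.add_mulVec, Matrix.smul_mulVec, Matrix.smul_mulVec]
  exact Submodule.add_mem _ (Submodule.smul_mem _ _ (hM f t x hx))
    (Submodule.smul_mem _ _ (hN f t x hx))

variable [Finite V] [∀ i j : V, Finite (i ⟶ j)]

theorem dense_orbit_fibre {M : QuiverRep k d} {U : GLd k d ⧸ parabolic F}
    (hU : (⟨M, U⟩ : RepProdFlag F) ∈ incidence F)
    (hx : Dense (MulAction.orbit (GLd k d) (⟨⟨M, U⟩, hU⟩ : incidence F))) :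
    Dense (MulAction.orbit (autQ M) (⟨U, hU⟩ : fibre F M)) := by
  refine dense_coe_iff.mpr fun B hB hsub U₁ hU₁ => ?_
  obtain ⟨D, hD, hDM, g, hg, hgM, hsec⟩ := exists_local_section M
  -- `B` is transported along the section to the fibres over nearby representations. Points with `D
  -- = 0` are included, so that the complement of `C` is open inside the open set `D ≠ 0`.
  let C : Set (RepProdFlag F) := {y | ∀ h : D y.rep ≠ 0, (g ⟨y.rep, h⟩)⁻¹ • y.flag ∈ B}
  have hC : IsClosed C := by
    have hD' : (fun x : QuiverRep k d × GLd k d => D x.1) ∈ regularFunctions repGLCoord :=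
      comp_mem_regularFunctions isRegularRep_fst.coord_mem hD
    let φ : {x : QuiverRep k d × GLd k d // D x.1 ≠ 0} → GLd k d :=
      fun x => (g ⟨x.1.1, x.2⟩)⁻¹ * x.1.2
    have hφ : IsRegularGL (fun x => repGLCoord x.1) φ := by
      refine IsRegularGL.mul (IsRegularGL.inv fun i p q => ?_) fun i p q => ?_
      · exact comp_mem_regularFunctions (Y := {N : QuiverRep k d // D N ≠ 0})
          (φ := fun x : {x : QuiverRep k d × GLd k d // D x.1 ≠ 0} => ⟨x.1.1, x.2⟩)
          (fun j => coord_mem_regularFunctions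
            (fun x : {x : QuiverRep k d × GLd k d // D x.1 ≠ 0} => repGLCoord x.1) (Sum.inl j))
          (hg i p q)
      · exact coord_mem_regularFunctions
          (fun x : {x : QuiverRep k d × GLd k d // D x.1 ≠ 0} => repGLCoord x.1)
          (Sum.inr ⟨i, p, q⟩)
    have hopen := isOpen_image_subtype_val hD' (@IsOpen.preimage _ _
      ((affineZariski k _).induced fun x : {x // D x.1 ≠ 0} => repGLCoord x.1) _ _ hφ.continuous _
      (hB.isOpen_compl.preimage QuotientGroup.continuous_mk))
    have e : (RepProdFlag.mkCoset F ⁻¹' C)ᶜ =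
        Subtype.val '' (φ ⁻¹' ((fun a : GLd k d => (a : GLd k d ⧸ parabolic F)) ⁻¹' Bᶜ)) := by
      ext x
      simp only [Set.mem_compl_iff, Set.mem_preimage, Set.mem_image, Subtype.exists]
      constructor
      · intro hx
        obtain ⟨h, hh⟩ := not_forall.mp hx
        exact ⟨x, h, hh, rfl⟩
      · rintro ⟨y, h, hh, rfl⟩ hx
        exact hh (hx h)
    rw [RepProdFlag.isClosed_iff, ← @isOpen_compl_iff _ _ zariskiRepGL, e]
    exact hopen
  have := dense_coe_iff.mp hx C hC ?_ ⟨M, U₁⟩ hU₁ hDM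
  · change (g ⟨M, hDM⟩)⁻¹ • U₁ ∈ B at this
    rwa [hgM, inv_one, one_smul] at this
  · rintro _ ⟨a, rfl⟩ (h : D (a • M) ≠ 0)
    change (g ⟨a • M, h⟩)⁻¹ • a • U ∈ B
    -- Both `a` and the value of the section at `a • M` carry `M` to `a • M`.
    have ha : (g ⟨a • M, h⟩)⁻¹ * a ∈ autQ M := by
      rw [mem_autQ_iff, mul_smul, inv_smul_eq_iff]
      exact (hsec ⟨a • M, h⟩ (subset_closure ⟨a, rfl⟩)).symm
    have := hsub _ ⟨⟨_, ha⟩, rfl⟩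
    change ((g ⟨a • M, h⟩)⁻¹ * a) • U ∈ B at this
    rwa [mul_smul] at this

/-- Every point of a dense orbit may serve as its base point, here the translate `g • x`. -/
theorem hasDenseOrbit_fibre_of_mem_orbit {x : incidence F}
    (hx : Dense (MulAction.orbit (GLd k d) x)) (g : GLd k d) :
    HasDenseOrbit (autQ (g • x.1.rep)) (fibre F (g • x.1.rep)) := by
  rw [← MulAction.orbit_smul g x] at hx
  exact ⟨_, dense_orbit_fibre (g • x).2 hx⟩

theorem dense_orbit_incidence [Infinite k] {M : QuiverRep k d} {U : GLd k d ⧸ parabolic F}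
    (hU : (⟨M, U⟩ : RepProdFlag F) ∈ incidence F)
    (hM : Dense (MulAction.orbit (GLd k d)
      (⟨M, rep_mem_collapseImage hU⟩ : collapseImage F)))
    (hf : Dense (MulAction.orbit (autQ M) (⟨U, hU⟩ : fibre F M))) :
    Dense (MulAction.orbit (GLd k d) (⟨⟨M, U⟩, hU⟩ : incidence F)) := by
  refine dense_coe_iff.mpr fun C hC hsub y hy => ?_
  -- Density in the fibre over `M`, translated by `a`, fills the fibre over `a • M`.
  have horbit : ∀ (a : GLd k d) (h : GLd k d), RepProdFlag.mkCoset F (a • M, h) ∈ incidence F →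
      RepProdFlag.mkCoset F (a • M, h) ∈ C := by
    intro a h hh
    have hcont : Continuous (fun b : GLd k d => RepProdFlag.mkCoset F (a • M, a * b)) :=
      (isRegularRep_const (a • M)).continuous_mkCoset ((isRegularGL_const a).mul isRegularGL_id)
    have hcl : IsClosed {W : GLd k d ⧸ parabolic F | (⟨a • M, a • W⟩ : RepProdFlag F) ∈ C} := by
      refine isClosed_coinduced.mpr ?_
      exact hC.preimage hcont
    have hmem : ((a⁻¹ * h : GLd k d) : GLd k d ⧸ parabolic F) ∈ fibre F M := by
      have := (incidence F).smul_mem a⁻¹ hh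
      rw [RepProdFlag.smul_mkCoset, inv_smul_smul] at this
      exact this
    have := dense_coe_iff.mp hf _ hcl ?_ _ hmem
    · change RepProdFlag.mkCoset F (a • M, a * (a⁻¹ * h)) ∈ C at this
      rwa [mul_inv_cancel_left] at this
    · rintro _ ⟨b, rfl⟩
      have := hsub _ ⟨a * b, rfl⟩
      change (⟨(a * b.1) • M, (a * b.1) • U⟩ : RepProdFlag F) ∈ C at this
      rw [mul_smul, mul_smul, smul_eq_of_mem_autQ b.2] at this
      exact this
  have himage : ∀ N ∈ collapseImage F, N ∈ closure (MulAction.orbit (GLd k d) M) := by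
    refine dense_coe_iff.mp hM _ isClosed_closure ?_
    rintro _ ⟨a, rfl⟩
    exact subset_closure ⟨a, rfl⟩
  obtain ⟨D, hD, hDM, g, -, -, hsec⟩ := exists_local_section M
  obtain ⟨S, hS⟩ := isClosed_induced_affineZariski_iff.mp (RepProdFlag.isClosed_iff.mp hC)
  obtain ⟨⟨N, h⟩, rfl⟩ := RepProdFlag.mkCoset_surjective y
  obtain ⟨g₀, hg₀⟩ := mem_collapseImage_iff.mp (rep_mem_collapseImage hU)
  have hN := mkCoset_mem_incidence.mp hy
  obtain ⟨δ, l, hl, ⟨t₀, ht₀, hlt₀⟩, ⟨t₁, ht₁, hlt₁⟩⟩ := exists_regularGL_line h g₀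
  -- Both factors of `GL_d × R_dd` are joined by lines: `h` to `g₀` in `GL_d`, and `h⁻¹ • N` to
  -- `g₀⁻¹ • M` in the linear space `repFlag F`. The image curve runs inside the incidence variety
  -- from the given point to one over `M`.
  let r : {t : Unit → k // MvPolynomial.eval t δ ≠ 0} → QuiverRep k d := fun t _ _ f =>
    (1 - t.1 ()) • (h⁻¹ • N) f + t.1 () • (g₀⁻¹ • M) f
  have hr : IsRegularRep (fun t => t.1) r := by
    intro i j f p q
    have ht := coord_mem_regularFunctions
      (fun t : {t : Unit → k // MvPolynomial.eval t δ ≠ 0} => t.1) ()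
    exact add_mem (mul_mem (sub_mem (const_mem _ 1) ht) (const_mem _ ((h⁻¹ • N) f p q)))
      (mul_mem ht (const_mem _ ((g₀⁻¹ • M) f p q)))
  have hr₀ : l t₀ • r t₀ = N := by
    have : r t₀ = h⁻¹ • N := by
      funext i j f
      simp [r, ht₀]
    rw [this, hlt₀, smul_inv_smul]
  have hr₁ : l t₁ • r t₁ = M := by
    have : r t₁ = g₀⁻¹ • M := by
      funext i j f
      simp [r, ht₁]
    rw [this, hlt₁, smul_inv_smul]
  have hinc : ∀ t, RepProdFlag.mkCoset F (l t • r t, l t) ∈ incidence F := fun t => by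
    rw [mkCoset_mem_incidence, inv_smul_smul]
    exact repFlag_convex hN hg₀ _ _
  have hreg := IsRegularRep.smul hl hr
  have hmem : (N, h) ∈ RepProdFlag.mkCoset F ⁻¹' C := by
    rw [hS]
    intro p hp
    -- Where `D ≠ 0`, the section puts the point over the orbit of `M`, hence in `C`, and the
    -- equation `p` of `C` vanishes there.
    have hmul : ∀ t, D (l t • r t) * MvPolynomial.eval (repGLCoord (l t • r t, l t)) p = 0 := by
      intro t
      by_cases ht : D (l t • r t) = 0
      · rw [ht, zero_mul]
      · obtain ⟨a, ha⟩ : ∃ a : GLd k d, a • M = l t • r t :=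
          ⟨_, hsec ⟨l t • r t, ht⟩ (himage _ (rep_mem_collapseImage (hinc t)))⟩
        have h1 : (l t • r t, l t) ∈ RepProdFlag.mkCoset F ⁻¹' C := by
          have h2 := hinc t
          change RepProdFlag.mkCoset F (l t • r t, l t) ∈ C
          rw [← ha] at h2 ⊢
          exact horbit _ _ h2
        rw [hS] at h1
        rw [show MvPolynomial.eval (repGLCoord (l t • r t, l t)) p = 0 from h1 p hp, mul_zero]
    rcases eq_zero_or_eq_zero_of_mul_regularFunctions δ
      (comp_mem_regularFunctions hreg.coord_mem hD) (eval_mem _ (hreg.repGLCoord_mem hl) p)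
      hmul with h0 | h0
    -- `D` is nonzero at the end of the curve over `M`, so it is `p` that vanishes along the whole
    -- curve.
    · exact absurd (hr₁ ▸ h0 t₁) hDM
    · have := h0 t₀
      rw [hr₀, hlt₀] at this
      exact this
  exact hmem

end Collapse

end QuiverRichardson

theorem mainTheorem4 {V : Type*} [Quiver V] [Finite V] [∀ i j : V, Finite (i ⟶ j)]
    {k : Type*} [Field k] [IsAlgClosed k] {d : V → ℕ} {s : ℕ}
    (dd : QuiverRichardson.DimFiltration d s) (F : QuiverRichardson.GradedFlag k dd) :
    List.TFAE [
      QuiverRichardson.HasDenseOrbit (QuiverRichardson.parabolic F) (QuiverRichardson.repFlag F),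
      QuiverRichardson.HasDenseOrbit (QuiverRichardson.GLd k d) (QuiverRichardson.incidence F),
      ∃ N : QuiverRichardson.collapseImage F,
        Dense (MulAction.orbit (QuiverRichardson.GLd k d) N) ∧
        ∀ M ∈ MulAction.orbit (QuiverRichardson.GLd k d) N,
          QuiverRichardson.HasDenseOrbit (QuiverRichardson.autQ (M : QuiverRichardson.QuiverRep k d))
            (QuiverRichardson.fibre F (M : QuiverRichardson.QuiverRep k d))] := by
  have : Infinite k := IsAlgClosed.instInfinite
  tfae_have 1 → 2 := QuiverRichardson.hasDenseOrbit_incidence_of_repFlag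
  tfae_have 2 → 1 := QuiverRichardson.hasDenseOrbit_repFlag_of_incidence
  tfae_have 2 → 3 := by
    rintro ⟨x, hx⟩
    refine ⟨_, QuiverRichardson.dense_orbit_rep hx, ?_⟩
    rintro _ ⟨g, rfl⟩
    exact QuiverRichardson.hasDenseOrbit_fibre_of_mem_orbit hx g
  tfae_have 3 → 2 := by
    rintro ⟨N, hN, hfib⟩
    obtain ⟨U, hU⟩ := hfib N (MulAction.mem_orbit_self N)
    exact ⟨⟨⟨N, U⟩, U.2⟩, QuiverRichardson.dense_orbit_incidence U.2 hN hU⟩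
  tfae_finish
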